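/- A satellite at altitude $h>0$ above a spherical Earth of radius $r_e>0$ moves with constant angular velocity $\omega>0$ on a great-circle orbit (in the Earth-fixed frame) and transmits at carrier frequency $f_o>0$; $c>0$ is the speed of light. Put $k=\frac{r_e}{r_e+h}$ and $\rho=\frac{f_o r_e\omega}{c}$. Fix an instant $t$. For a user on the Earth's surface let $\Upsilon_t$ be its central angle to the satellite, $\Upsilon_{\min}$ its minimum central angle to the orbit, and $$\delta_t=\rho\,\frac{\sqrt{\cos^2\Upsilon_{\min}-\cos^2\Upsilon_t}}{\sqrt{1+k^2-2k\cos\Upsilon_t}}$$ its Doppler shift magnitude, i.e. $\frac{f_o}{c}$ times the absolute value of the time derivative of its distance to the satellite. Let the user be uniformly distributed in a spherical cap cell with centre $C$ and angular radius $\theta_c>0$, let $\theta_v$ be the central angle between $C$ and the satellite, and assume $\theta_v+\theta_c<\frac{\pi}{2}$ (which holds whenever the satellite is visible from the whole cell). Let $$\widetilde\delta_t(\Upsilon)=\rho\,(r_e+h)\frac{\Upsilon}{\sqrt{h^2+r_e(r_e+h)\Upsilon^2}}$$ be the small-angle form of the Doppler magnitude for $\Upsilon_{\min}=0$. For real $s$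 with $k s^2<\rho^2$ put $$\widetilde F_\delta(s)=F_{\Upsilon_t}\!\left(\frac{\frac{h}{r_e+h}\,s}{\sqrt{\rho^2-\frac{r_e}{r_e+h}s^2}},\ \theta_c\,\Big|\,\theta_v\right).$$ Here $F_{\Upsilon_t}(\gamma,\theta_c\mid\theta_v)$ is $0$ if $\gamma<0$ or $\gamma<\theta_v-\theta_c$, is $1$ if $\gamma>\theta_c+\theta_v$, and otherwise is given by the first of the following cases that applies: 1. $\gamma\le\theta_c-\theta_v$: $\ \frac{1-\cos\gamma}{1-\cos\theta_c}$; 2. $\theta_c>\theta_v$ and $\cos\gamma\cos\theta_v\ge\cos\theta_c$: $\ \frac{1-\cos\gamma}{1-\cos\theta_c}+\frac{V_{\theta_v+\theta_{\min},\theta_c}-V_{\theta_{\min},\gamma}}{2(1-\cos\theta_c)}$ with $\theta_{\min}=\arctan\big(\frac1{\tan\theta_v}-\frac{\cos\theta_c}{\cos\gamma\sin\theta_v}\big)$; 3. $\theta_v<\gamma\le\theta_c+\theta_v$ and $\cos\gamma\le\cos\theta_c\cos\theta_v$: $\ 1+\frac{V_{\theta_v+\theta_{\min},\gamma}-V_{\theta_{\min},\theta_c}}{2(1-\cos\theta_c)}$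 with $\theta_{\min}=\arctan\big(\frac1{\tan\theta_v}-\frac{\cos\gamma}{\cos\theta_c\sin\theta_v}\big)$; 4. otherwise: $\ \frac{V_{\theta_{\min},\theta_c}+V_{\theta_v-\theta_{\min},\gamma}}{2(1-\cos\theta_c)}$ with $\theta_{\min}=\arctan\big(\frac{\cos\gamma}{\cos\theta_c\sin\theta_v}-\frac1{\tan\theta_v}\big)$; where $V_{u,v}=\int_u^v\sin\phi\; I_{1-(\tan u/\tan\phi)^2}\big(\tfrac12,\tfrac12\big)\,d\phi$ and $I_x(\cdot,\cdot)$ is the regularized incomplete beta function. Then $\widetilde F_\delta$ is the distribution function of an upper bound of the Doppler shift magnitude: $\delta_t\le\widetilde\delta_t(\Upsilon_t)$ for every user, $\widetilde F_\delta(s)=\Pr\big(\widetilde\delta_t(\Upsilon_t)\le s\big)$, and consequently the distribution function $F_\delta(s)=\Pr(\delta_t\le s)$ of the Doppler shift magnitude is bounded by $\widetilde F_\delta$ in the sense that $$\widetilde F_\delta(s)\le F_\delta(s).$$ -/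

import Mathlib

open MeasureTheory
open scoped RealInnerProductSpace

namespace LeoDoppler

/-- Earth-centred fixed three-dimensional space. -/
abbrev Space : Type := EuclideanSpace ℝ (Fin 3)

/-- The directions seen from the Earth's centre. A direction `x` stands for the point `rₑ • x` of
the Earth's surface. -/
abbrev Direction : Type := Metric.sphere (0 : Space) 1

section Geometry

/-- The direction, at time `τ`, of a satellite that runs with constant angular velocity `ω` along
the great circle spanned by the orthonormal vectors `u`, `w`; equivalently, the direction of its
projection `P_τ` onto the Earth's surface. -/
noncomputable def subsatellite (u w : Space) (ω τ : ℝ) : Space :=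
  Real.cos (ω * τ) • u + Real.sin (ω * τ) • w

/-- The central angle `Υ_t` between the user in direction `x` and the satellite at time `t`. -/
noncomputable def centralAngle (u w : Space) (ω t : ℝ) (x : Space) : ℝ :=
  InnerProductGeometry.angle x (subsatellite u w ω t)

/-- The minimum central angle `Υ_min` between the user in direction `x` and the orbit. -/
noncomputable def minCentralAngle (u w : Space) (ω : ℝ) (x : Space) : ℝ :=
  ⨅ τ : ℝ, centralAngle u w ω τ x

/-- The slant distance at time `τ` between the satellite, at altitude `h`, and the user in
direction `x` on the surface of the Earth, whose radius is `re`. -/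
noncomputable def slantDistance (re h : ℝ) (u w : Space) (ω τ : ℝ) (x : Space) : ℝ :=
  dist ((re + h) • subsatellite u w ω τ) (re • x)

/-- The magnitude `δ_t` of the Doppler shift of the carrier frequency `fo` at the user in direction
`x`: carrier frequency times the relative (range) speed, divided by the speed of light `c`. -/
noncomputable def dopplerMagnitude (fo c re h : ℝ) (u w : Space) (ω t : ℝ) (x : Space) : ℝ :=
  fo / c * |deriv (fun τ => slantDistance re h u w ω τ x) t|

/-- The factor `ρ = fₒ rₑ ω / c`. -/
noncomputable def rho (fo c re ω : ℝ) : ℝ := fo * re * ω / c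

/-- The small-angle form of the Doppler magnitude on the ground track (`Υ_min = 0`), as a function
of the central angle `Υ`. -/
noncomputable def groundTrackApprox (re h ρ Υ : ℝ) : ℝ :=
  ρ * (re + h) * (Υ / Real.sqrt (h ^ 2 + re * (re + h) * Υ ^ 2))

/-- The cell `S(C, θc)`: the spherical cap of angular radius `θc` with centre `C`. -/
def cell (C : Direction) (θc : ℝ) : Set Direction :=
  {x | InnerProductGeometry.angle (x : Space) (C : Space) ≤ θc}

end Geometry

section CentralAngleDistribution

/-- The regularized incomplete beta function `I_x(a, b)`. -/
noncomputable def regIncBeta (a b x : ℝ) : ℝ :=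
  (∫ t in (0 : ℝ)..x, t ^ (a - 1) * (1 - t) ^ (b - 1)) / ProbabilityTheory.beta a b

/-- `V_{u,v} = ∫_u^v sin φ · I_{1 - (tan u / tan φ)²}(1/2, 1/2) dφ`. -/
noncomputable def V (u v : ℝ) : ℝ :=
  ∫ φ in u..v,
    Real.sin φ * regIncBeta (1 / 2) (1 / 2) (1 - (Real.tan u / Real.tan φ) ^ 2)

/-- `θ_min` in the second case of the distribution function of the central angle. -/
noncomputable def thetaMin₂ (γ θc θv : ℝ) : ℝ :=
  Real.arctan (1 / Real.tan θv - Real.cos θc / (Real.cos γ * Real.sin θv))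

/-- `θ_min` in the third case. -/
noncomputable def thetaMin₃ (γ θc θv : ℝ) : ℝ :=
  Real.arctan (1 / Real.tan θv - Real.cos γ / (Real.cos θc * Real.sin θv))

/-- `θ_min` in the fourth case. -/
noncomputable def thetaMin₄ (γ θc θv : ℝ) : ℝ :=
  Real.arctan (Real.cos γ / (Real.cos θc * Real.sin θv) - 1 / Real.tan θv)

open Classical in
/-- The closed-form distribution function `F_Υ(γ, θc ∣ θv)` of the central angle. The branches that
are not constant are Cases 1 to 4 of the closed form, tested in this order; the three constant
branches give the values of a distribution function outside the range of the central angle, namely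
`0` for `γ < 0` and for `γ < θv - θc`, and `1` for `γ > θc + θv`. -/
noncomputable def centralAngleCDF (γ θc θv : ℝ) : ℝ :=
  if γ < 0 then 0
  else if γ ≤ θc - θv then
    (1 - Real.cos γ) / (1 - Real.cos θc)
  else if γ < θv - θc then 0
  else if θc + θv < γ then 1
  else if θv < θc ∧ Real.cos θc ≤ Real.cos γ * Real.cos θv then
    (1 - Real.cos γ) / (1 - Real.cos θc)
      + 1 / (2 * (1 - Real.cos θc))
        * (V (θv + thetaMin₂ γ θc θv) θc - V (thetaMin₂ γ θc θv) γ)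
  else if (θv < γ ∧ γ ≤ θc + θv) ∧ Real.cos γ ≤ Real.cos θc * Real.cos θv then
    1 + 1 / (2 * (1 - Real.cos θc))
        * (V (θv + thetaMin₃ γ θc θv) γ - V (thetaMin₃ γ θc θv) θc)
  else
    1 / (2 * (1 - Real.cos θc))
      * (V (thetaMin₄ γ θc θv) θc + V (θv - thetaMin₄ γ θc θv) γ)

/-- The bound `F_Υ(((h / (rₑ + h)) s) / √(ρ² - (rₑ / (rₑ + h)) s²), θc ∣ θv)`. -/
noncomputable def dopplerBound (re h ρ θc θv s : ℝ) : ℝ :=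
  centralAngleCDF (h / (re + h) * s / Real.sqrt (ρ ^ 2 - re / (re + h) * s ^ 2)) θc θv

end CentralAngleDistribution

section ClosedForm

variable {u w : Space}

lemma inner_subsatellite (u w : Space) (ω τ : ℝ) (x : Space) :
    ⟪x, subsatellite u w ω τ⟫ = Real.cos (ω * τ) * ⟪x, u⟫ + Real.sin (ω * τ) * ⟪x, w⟫ := by
  simp [subsatellite, inner_add_right, inner_smul_right]

lemma norm_subsatellite (hu : ‖u‖ = 1) (hw : ‖w‖ = 1) (huw : ⟪u, w⟫ = 0) (ω τ : ℝ) :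
    ‖subsatellite u w ω τ‖ = 1 := by
  have h : ‖subsatellite u w ω τ‖ ^ 2 = 1 := by
    rw [subsatellite, norm_add_sq_real]
    simp [norm_smul, inner_smul_left, inner_smul_right, hu, hw, huw]
  have h0 := norm_nonneg (subsatellite u w ω τ)
  nlinarith

lemma cos_centralAngle (hu : ‖u‖ = 1) (hw : ‖w‖ = 1) (huw : ⟪u, w⟫ = 0) (ω τ : ℝ)
    {x : Space} (hx : ‖x‖ = 1) :
    Real.cos (centralAngle u w ω τ x)
      = Real.cos (ω * τ) * ⟪x, u⟫ + Real.sin (ω * τ) * ⟪x, w⟫ := by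
  rw [centralAngle, InnerProductGeometry.cos_angle, hx, norm_subsatellite hu hw huw,
    inner_subsatellite]
  simp

lemma cos_sq_minCentralAngle (hu : ‖u‖ = 1) (hw : ‖w‖ = 1) (huw : ⟪u, w⟫ = 0) {ω : ℝ}
    (hω : ω ≠ 0) {x : Space} (hx : ‖x‖ = 1) :
    Real.cos (minCentralAngle u w ω x) ^ 2 = ⟪x, u⟫ ^ 2 + ⟪x, w⟫ ^ 2 := by
  set a := ⟪x, u⟫ with ha
  set b := ⟪x, w⟫ with hb
  set R := Real.sqrt (a ^ 2 + b ^ 2) with hR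
  have hR2 : R ^ 2 = a ^ 2 + b ^ 2 := Real.sq_sqrt (by positivity)
  have hR0 : 0 ≤ R := Real.sqrt_nonneg _
  have hcos : ∀ τ, Real.cos (centralAngle u w ω τ x)
      = Real.cos (ω * τ) * a + Real.sin (ω * τ) * b :=
    fun τ => cos_centralAngle hu hw huw ω τ hx
  have hle : ∀ τ, Real.cos (centralAngle u w ω τ x) ≤ R := by
    intro τ
    rw [hcos]
    apply Real.le_sqrt_of_sq_le
    nlinarith [sq_nonneg (Real.cos (ω * τ) * b - Real.sin (ω * τ) * a),
      Real.sin_sq_add_cos_sq (ω * τ)]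
  obtain ⟨τ₀, hτ₀⟩ : ∃ τ, Real.cos (centralAngle u w ω τ x) = R := by
    set z : ℂ := ⟨a, b⟩ with hz
    have hn : ‖z‖ = R := by
      rw [hR, Complex.norm_eq_sqrt_sq_add_sq]
    refine ⟨Complex.arg z / ω, ?_⟩
    rw [hcos, mul_div_cancel₀ _ hω]
    have h1 := Complex.norm_mul_cos_arg z
    have h2 := Complex.norm_mul_sin_arg z
    have h3 := Real.sin_sq_add_cos_sq (Complex.arg z)
    rw [hn] at h1 h2
    have h1' : a = R * Real.cos (Complex.arg z) := h1.symm
    have h2' : b = R * Real.sin (Complex.arg z) := h2.symm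
    linear_combination Real.cos (Complex.arg z) * h1' + Real.sin (Complex.arg z) * h2' + R * h3
  have hmin : minCentralAngle u w ω x = centralAngle u w ω τ₀ x := by
    apply le_antisymm
    · exact ciInf_le ⟨0, by rintro _ ⟨τ, rfl⟩; exact InnerProductGeometry.angle_nonneg _ _⟩ τ₀
    · refine le_ciInf fun τ => ?_
      by_contra hlt
      push Not at hlt
      have := Real.cos_lt_cos_of_nonneg_of_le_pi
        (InnerProductGeometry.angle_nonneg x (subsatellite u w ω τ))
        (InnerProductGeometry.angle_le_pi x (subsatellite u w ω τ₀)) hlt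
      have h4 := hle τ
      unfold centralAngle at hτ₀ h4
      linarith
  rw [hmin, hτ₀, hR2]

/-- The Doppler magnitude in terms of the central angle and the minimum central angle,
`δ_t = ρ √(cos² Υ_min - cos² Υ_t) / √(1 + k² - 2 k cos Υ_t)` with `k = rₑ / (rₑ + h)`. -/
theorem dopplerMagnitude_eq {fo c re h ω : ℝ} (hfo : 0 < fo) (hc : 0 < c) (hre : 0 < re)
    (hh : 0 < h) (hω : 0 < ω) (hu : ‖u‖ = 1) (hw : ‖w‖ = 1) (huw : ⟪u, w⟫ = 0) (t : ℝ)
    {x : Space} (hx : ‖x‖ = 1) :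
    dopplerMagnitude fo c re h u w ω t x =
      rho fo c re ω
        * (Real.sqrt (Real.cos (minCentralAngle u w ω x) ^ 2
            - Real.cos (centralAngle u w ω t x) ^ 2)
          / Real.sqrt (1 + (re / (re + h)) ^ 2
            - 2 * (re / (re + h)) * Real.cos (centralAngle u w ω t x))) := by
  rw [cos_sq_minCentralAngle hu hw huw hω.ne' hx, cos_centralAngle hu hw huw ω t hx]
  set a := ⟪x, u⟫ with ha
  set b := ⟪x, w⟫ with hb
  set g : ℝ → ℝ := fun τ => Real.cos (ω * τ) * a + Real.sin (ω * τ) * b with hg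
  have hslant : ∀ τ, slantDistance re h u w ω τ x
      = Real.sqrt (re ^ 2 + (re + h) ^ 2 - 2 * re * (re + h) * g τ) := by
    intro τ
    rw [slantDistance, dist_eq_norm, ← Real.sqrt_sq (norm_nonneg _), norm_sub_sq_real]
    congr 1
    have h1 : ⟪(re + h) • subsatellite u w ω τ, re • x⟫ = (re + h) * re * g τ := by
      rw [inner_smul_left, inner_smul_right, real_inner_comm, inner_subsatellite]
      simp [hg, ha, hb]
      ring
    rw [h1, norm_smul, norm_smul, norm_subsatellite hu hw huw, hx]
    simp only [Real.norm_eq_abs, mul_one, sq_abs]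
    ring
  have hgle : ∀ τ, g τ ≤ 1 := by
    intro τ
    have := cos_centralAngle hu hw huw ω τ hx
    have h2 := Real.cos_le_one (centralAngle u w ω τ x)
    rw [this] at h2
    exact h2
  have hpos : ∀ τ, 0 < re ^ 2 + (re + h) ^ 2 - 2 * re * (re + h) * g τ := by
    intro τ
    have : 0 ≤ 2 * re * (re + h) * (1 - g τ) :=
      mul_nonneg (by positivity) (by linarith [hgle τ])
    nlinarith [sq_pos_of_pos hh]
  have hgd : HasDerivAt g (-Real.sin (ω * t) * ω * a + Real.cos (ω * t) * ω * b) t := by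
    have hlin : HasDerivAt (fun τ : ℝ => ω * τ) ω t := by
      simpa using (hasDerivAt_id t).const_mul ω
    exact (hlin.cos.mul_const a).add (hlin.sin.mul_const b)
  set g' := -Real.sin (ω * t) * ω * a + Real.cos (ω * t) * ω * b with hg'
  have hd : HasDerivAt (fun τ => slantDistance re h u w ω τ x)
      (-(2 * re * (re + h) * g')
        / (2 * Real.sqrt (re ^ 2 + (re + h) ^ 2 - 2 * re * (re + h) * g t))) t := by
    have h1 : (fun τ => slantDistance re h u w ω τ x)
        = fun τ => Real.sqrt (re ^ 2 + (re + h) ^ 2 - 2 * re * (re + h) * g τ) :=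
      funext hslant
    rw [h1]
    exact ((hgd.const_mul (2 * re * (re + h))).const_sub (re ^ 2 + (re + h) ^ 2)).sqrt
      (hpos t).ne'
  have hsq : a ^ 2 + b ^ 2 - g t ^ 2 = (g' / ω) ^ 2 := by
    have h3 := Real.sin_sq_add_cos_sq (ω * t)
    have h4 : g' / ω = -Real.sin (ω * t) * a + Real.cos (ω * t) * b := by
      rw [hg']; field_simp
    rw [h4]
    simp only [hg]
    linear_combination (-(a ^ 2 + b ^ 2)) * h3
  have hden : Real.sqrt (re ^ 2 + (re + h) ^ 2 - 2 * re * (re + h) * g t)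
      = (re + h) * Real.sqrt (1 + (re / (re + h)) ^ 2 - 2 * (re / (re + h)) * g t) := by
    have h5 : re ^ 2 + (re + h) ^ 2 - 2 * re * (re + h) * g t
        = (re + h) ^ 2 * (1 + (re / (re + h)) ^ 2 - 2 * (re / (re + h)) * g t) := by
      field_simp
      ring
    rw [h5, Real.sqrt_mul (by positivity), Real.sqrt_sq (by positivity)]
  have hS : 0 < Real.sqrt (1 + (re / (re + h)) ^ 2 - 2 * (re / (re + h)) * g t) := by
    have h6 := Real.sqrt_pos.mpr (hpos t)
    rw [hden] at h6
    exact pos_of_mul_pos_right h6 (by positivity)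
  change _ = rho fo c re ω * (Real.sqrt (a ^ 2 + b ^ 2 - g t ^ 2)
    / Real.sqrt (1 + (re / (re + h)) ^ 2 - 2 * (re / (re + h)) * g t))
  rw [dopplerMagnitude, hd.deriv, hsq, Real.sqrt_sq_eq_abs, hden, abs_div, abs_div, abs_neg,
    abs_mul, abs_of_pos (show 0 < 2 * re * (re + h) by positivity), abs_of_pos hω,
    abs_of_pos (show 0 < 2 * ((re + h)
      * Real.sqrt (1 + (re / (re + h)) ^ 2 - 2 * (re / (re + h)) * g t)) by positivity), rho]
  field_simp

end ClosedForm

end LeoDoppler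

namespace LeoDoppler

/-! Replacing `cos² Υ_min` by 1 bounds the Doppler magnitude by `ρ sin Υ / √(1 + k² - 2k cos Υ)`.
Since `1 + k² - 2k cos Υ = (1 - k)² + 2k(1 - cos Υ)`, the two estimates `sin² Υ ≤ Υ²` and `sin² Υ ≤
2(1 - cos Υ)` turn this into the small-angle form (`sin_sq_mul_le`). That form increases with `Υ ≥
0`, so its being at most `s` is an event `Υ_t ≤ γ` with explicit `γ` (`groundTrackApprox_le_iff`),
and the comparison of distribution functions is an inclusion of events.

Most of the work is that the closed form is the distribution function of `Υ_t`, that is, the area of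
the intersection of the cell with the cap of radius `γ` around the subsatellite point, divided by
the area of the cell. Once the trivial cases are set aside, a great circle cuts this lens into two
cap segments (`toSphere_lens`), and in spherical coordinates a segment has area `2 ∫ sin φ arccos (m
/ tan φ) dφ` (`toSphere_segment`). The beta factor in `V` is this arc cosine (`regIncBeta_half`), so
`V` is a segment area up to a constant, provided the slope `m` is nonnegative (`V_eq_halfSegment`).
The arctangents of the two slopes add up to `θv` (`arctan_chordSlope_add`), which explains the
paired angles in the formula. Cases 2 to 4 differ in which slope, if any, is negative; a negative
slope is traded for the complementary segment (`halfSegment_neg`). -/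

/-! ### The incomplete beta function at parameters 1/2 as an arc cosine -/

lemma integral_arcsine_density {x : ℝ} (hx0 : 0 ≤ x) (hx1 : x ≤ 1) :
    ∫ t in (0 : ℝ)..x, t ^ ((1 / 2 : ℝ) - 1) * (1 - t) ^ ((1 / 2 : ℝ) - 1)
      = Real.arccos (1 - 2 * x) := by
  have hd : ∀ t ∈ Set.Ioo 0 x, HasDerivAt (fun t => Real.arccos (1 - 2 * t))
      (t ^ ((1 / 2 : ℝ) - 1) * (1 - t) ^ ((1 / 2 : ℝ) - 1)) t := by
    intro t ht
    have h0 : 0 < t := ht.1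
    have h1 : 0 < 1 - t := by linarith [ht.2]
    have h2 : HasDerivAt (fun t : ℝ => 1 - 2 * t) (-2) t := by
      simpa using ((hasDerivAt_id t).const_mul 2).const_sub 1
    have h3 := (Real.hasDerivAt_arccos (x := 1 - 2 * t) (by linarith) (by linarith)).comp t h2
    refine h3.congr_deriv ?_
    have h4 : (1 : ℝ) - (1 - 2 * t) ^ 2 = 2 ^ 2 * (t * (1 - t)) := by ring
    rw [h4, Real.sqrt_mul (by norm_num), Real.sqrt_sq (by norm_num), Real.sqrt_mul h0.le,
      show (1 / 2 : ℝ) - 1 = -(1 / 2) by norm_num, Real.rpow_neg h0.le, Real.rpow_neg h1.le,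
      ← Real.sqrt_eq_rpow, ← Real.sqrt_eq_rpow]
    have := Real.sqrt_pos.mpr h0
    have := Real.sqrt_pos.mpr h1
    field_simp
  have hc : ContinuousOn (fun t : ℝ => Real.arccos (1 - 2 * t)) (Set.Icc 0 x) :=
    (Real.continuous_arccos.comp (by fun_prop)).continuousOn
  -- The density is unbounded at 0 and, when `x = 1`, at 1. Its integrability comes from being the
  -- nonnegative derivative of a continuous function.
  have hnn : ∀ t ∈ Set.Ioo 0 x, (0 : ℝ) ≤ t ^ ((1 / 2 : ℝ) - 1) * (1 - t) ^ ((1 / 2 : ℝ) - 1) := by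
    intro t ht
    have h1 : 0 ≤ 1 - t := by linarith [ht.2]
    exact mul_nonneg (Real.rpow_nonneg ht.1.le _) (Real.rpow_nonneg h1 _)
  have hint := intervalIntegral.integrableOn_deriv_of_nonneg hc hd hnn
  rw [intervalIntegral.integral_eq_sub_of_hasDerivAt_of_le hx0 hc hd
    ((intervalIntegrable_iff_integrableOn_Ioc_of_le hx0).mpr hint)]
  simp

lemma beta_half_half : ProbabilityTheory.beta (1 / 2) (1 / 2) = Real.pi := by
  rw [ProbabilityTheory.beta, Real.Gamma_one_half_eq]
  norm_num [Real.mul_self_sqrt Real.pi_nonneg]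

/-- For `t < 0` the real power `t ^ (-1/2)` carries the factor `cos (-π/2) = 0` by convention, so
the integrand vanishes on the negative axis. -/
lemma regIncBeta_half_of_nonpos {x : ℝ} (hx : x ≤ 0) : regIncBeta (1 / 2) (1 / 2) x = 0 := by
  rw [regIncBeta, intervalIntegral.integral_symm]
  have : ∫ t in x..0, t ^ ((1 / 2 : ℝ) - 1) * (1 - t) ^ ((1 / 2 : ℝ) - 1) = 0 := by
    rw [intervalIntegral.integral_of_le hx]
    refine setIntegral_eq_zero_of_forall_eq_zero fun t ht => ?_
    rcases ht.2.lt_or_eq with h | h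
    · rw [Real.rpow_def_of_neg h, show ((1 / 2 : ℝ) - 1) * Real.pi = -(Real.pi / 2) by ring,
        Real.cos_neg, Real.cos_pi_div_two]
      simp
    · rw [h, Real.zero_rpow (by norm_num)]
      simp
  rw [this]
  simp

/-- The regularized incomplete beta function with both parameters `1/2` is an arc cosine. -/
lemma regIncBeta_half {z : ℝ} (hz : 0 ≤ z) :
    regIncBeta (1 / 2) (1 / 2) (1 - z ^ 2) = 2 / Real.pi * Real.arccos z := by
  rcases le_total z 1 with h1 | h1
  · rw [regIncBeta, beta_half_half, integral_arcsine_density (by nlinarith) (by nlinarith)]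
    -- Double angle formula at `arccos z`; the hypothesis `0 ≤ z` keeps the doubled angle within
    -- `[0, π]`.
    have : (1 : ℝ) - 2 * (1 - z ^ 2) = Real.cos (2 * Real.arccos z) := by
      rw [Real.cos_two_mul, Real.cos_arccos (by linarith) h1]; ring
    rw [this, Real.arccos_cos (by linarith [Real.arccos_nonneg z])
      (by linarith [Real.arccos_le_pi_div_two.mpr hz])]
    ring
  · rw [regIncBeta_half_of_nonpos (by nlinarith), Real.arccos_eq_zero.mpr h1, mul_zero]

/-! ### Segment integrals and their relation to `V` -/

/-- Half the area of the part of a spherical cap of angular radius `v` on which the cosine of the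
azimuth is at least `m / tan φ`, where `φ` is the angle to the centre of the cap. -/
noncomputable def halfSegment (m v : ℝ) : ℝ :=
  ∫ φ in (0 : ℝ)..v, Real.sin φ * Real.arccos (m / Real.tan φ)

lemma norm_sin_mul_arccos_le (φ y : ℝ) : ‖Real.sin φ * Real.arccos y‖ ≤ Real.pi := by
  rw [norm_mul, Real.norm_eq_abs, Real.norm_eq_abs, abs_of_nonneg (Real.arccos_nonneg y)]
  calc |Real.sin φ| * Real.arccos y ≤ 1 * Real.pi :=
        mul_le_mul (Real.abs_sin_le_one φ) (Real.arccos_le_pi y) (Real.arccos_nonneg y) zero_le_one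
    _ = Real.pi := one_mul _

lemma measurable_tan : Measurable Real.tan := by
  have : Real.tan = fun x => Real.sin x / Real.cos x := funext Real.tan_eq_sin_div_cos
  rw [this]
  exact Real.measurable_sin.div Real.measurable_cos

lemma measurable_segment_integrand (m : ℝ) :
    Measurable fun φ => Real.sin φ * Real.arccos (m / Real.tan φ) :=
  Real.measurable_sin.mul (Real.continuous_arccos.measurable.comp
    (measurable_const.div measurable_tan))

lemma intervalIntegrable_segment_integrand (m a b : ℝ) :
    IntervalIntegrable (fun φ => Real.sin φ * Real.arccos (m / Real.tan φ)) volume a b := by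
  rw [intervalIntegrable_iff]
  refine Measure.integrableOn_of_bounded (M := Real.pi) (by simp [Set.uIoc])
    (measurable_segment_integrand m).aestronglyMeasurable ?_
  exact Filter.Eventually.of_forall fun φ => norm_sin_mul_arccos_le φ _

lemma halfSegment_nonneg (m : ℝ) {v : ℝ} (hv0 : 0 ≤ v) (hv : v ≤ Real.pi) :
    0 ≤ halfSegment m v :=
  intervalIntegral.integral_nonneg hv0 fun _ hφ => mul_nonneg
    (Real.sin_nonneg_of_nonneg_of_le_pi hφ.1 (hφ.2.trans hv)) (Real.arccos_nonneg _)

/-- Since `arccos (-y) = π - arccos y`, the slopes `m` and `-m` give complementary parts of the cap.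
-/
lemma halfSegment_neg (m v : ℝ) :
    halfSegment (-m) v = Real.pi * (1 - Real.cos v) - halfSegment m v := by
  have h : ∫ φ in (0 : ℝ)..v, Real.sin φ * Real.pi = Real.pi * (1 - Real.cos v) := by
    rw [intervalIntegral.integral_mul_const, integral_sin, Real.cos_zero, mul_comm]
  have hi : IntervalIntegrable (fun φ => Real.sin φ * Real.pi) volume 0 v :=
    (Real.continuous_sin.mul continuous_const).intervalIntegrable _ _
  rw [halfSegment, halfSegment, ← h, ← intervalIntegral.integral_sub hi
    (intervalIntegrable_segment_integrand m 0 v)]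
  refine intervalIntegral.integral_congr fun φ _ => ?_
  simp only [neg_div, Real.arccos_neg]
  ring

/-- The square in `V` forgets the sign of `tan u / tan φ`, so the angles are kept in the first
quadrant, where the beta factor is the arc cosine. -/
lemma V_eq_halfSegment {u v : ℝ} (hu0 : 0 ≤ u) (hu : u < Real.pi / 2) (hv0 : 0 ≤ v)
    (hv : v < Real.pi / 2) : V u v = 2 / Real.pi * halfSegment (Real.tan u) v := by
  have h1 : V u v = ∫ φ in u..v, 2 / Real.pi *
      (Real.sin φ * Real.arccos (Real.tan u / Real.tan φ)) := by
    refine intervalIntegral.integral_congr fun φ hφ => ?_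
    have hφ0 : 0 ≤ φ := (le_min hu0 hv0).trans hφ.1
    have hφ1 : φ < Real.pi / 2 := hφ.2.trans_lt (max_lt hu hv)
    have h0 : 0 ≤ Real.tan u / Real.tan φ := div_nonneg
      (Real.tan_nonneg_of_nonneg_of_le_pi_div_two hu0 hu.le)
      (Real.tan_nonneg_of_nonneg_of_le_pi_div_two hφ0 hφ1.le)
    simp only [regIncBeta_half h0]
    ring
  -- For `φ ≤ u` the quotient of tangents is at least 1 and its `arccos` is 0, so the lower limit
  -- can be moved from `u` to 0.
  have h2 : ∫ φ in (0 : ℝ)..u, Real.sin φ * Real.arccos (Real.tan u / Real.tan φ) = 0 := by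
    rw [intervalIntegral.integral_of_le hu0]
    refine setIntegral_eq_zero_of_forall_eq_zero fun φ hφ => ?_
    have h3 : 0 < Real.tan φ := Real.tan_pos_of_pos_of_lt_pi_div_two hφ.1 (hφ.2.trans_lt hu)
    have h4 : Real.tan φ ≤ Real.tan u :=
      Real.strictMonoOn_tan.monotoneOn ⟨by linarith [hφ.1, Real.pi_pos], hφ.2.trans_lt hu⟩
        ⟨by linarith [Real.pi_pos], hu⟩ hφ.2
    rw [Real.arccos_eq_zero.mpr ((one_le_div h3).mpr h4), mul_zero]
  rw [h1, intervalIntegral.integral_const_mul, halfSegment,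
    ← intervalIntegral.integral_add_adjacent_intervals
      (intervalIntegrable_segment_integrand (Real.tan u) 0 u)
      (intervalIntegrable_segment_integrand (Real.tan u) u v), h2, zero_add]

/-! ### The great circle separating two caps -/

/-- The slope, seen from one of two cap centres at distance `θ`, of the great circle through the
common points of the two boundary circles; `α` is the radius of the cap around this centre and
`β` that of the other cap. -/
noncomputable def chordSlope (α β θ : ℝ) : ℝ :=
  Real.cos β / (Real.cos α * Real.sin θ) - 1 / Real.tan θ

/-- The separating great circle meets the great circle of centres at signed distances `δ` and `θ -
δ` from the two centres, and the slopes are the tangents of these distances. -/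
lemma arctan_chordSlope_add {α β θ : ℝ} (hα0 : 0 ≤ α) (hα : α < Real.pi / 2) (hβ0 : 0 ≤ β)
    (hβ : β < Real.pi / 2) (hθ0 : 0 < θ) (hθ : θ < Real.pi / 2) :
    Real.arctan (chordSlope α β θ) + Real.arctan (chordSlope β α θ) = θ := by
  have ha : 0 < Real.cos α := Real.cos_pos_of_mem_Ioo ⟨by linarith [Real.pi_pos], hα⟩
  have hb : 0 < Real.cos β := Real.cos_pos_of_mem_Ioo ⟨by linarith [Real.pi_pos], hβ⟩
  have hs : 0 < Real.sin θ := Real.sin_pos_of_pos_of_lt_pi hθ0 (by linarith [Real.pi_pos])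
  have hct : 0 < Real.cos θ := Real.cos_pos_of_mem_Ioo ⟨by linarith [Real.pi_pos], hθ⟩
  set δ := Real.arctan (chordSlope α β θ) with hδ
  have hcδ : 0 < Real.cos δ := Real.cos_arctan_pos _
  have htan : Real.sin δ = chordSlope α β θ * Real.cos δ := by
    rw [← Real.tan_arctan (chordSlope α β θ), ← hδ, Real.tan_mul_cos hcδ.ne']
  have hm : chordSlope α β θ * Real.sin θ = Real.cos β / Real.cos α - Real.cos θ := by
    rw [chordSlope, Real.tan_eq_sin_div_cos]
    field_simp
  have hm' : chordSlope β α θ * Real.sin θ = Real.cos α / Real.cos β - Real.cos θ := by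
    rw [chordSlope, Real.tan_eq_sin_div_cos]
    field_simp
  have hcos : Real.cos (θ - δ) = Real.cos δ * (Real.cos β / Real.cos α) := by
    rw [Real.cos_sub, htan]
    linear_combination Real.cos δ * hm
  have hsin : Real.sin (θ - δ) * Real.sin θ
      = Real.cos δ * (1 - Real.cos θ * (Real.cos β / Real.cos α)) := by
    rw [Real.sin_sub, htan]
    linear_combination (-Real.cos θ * Real.cos δ) * hm + Real.cos δ * Real.sin_sq_add_cos_sq θ
  -- Equal tangents give equal angles only within `(-π/2, π/2)`. The positive cosine, with `θ - δ <
  -- π`, excludes `θ - δ ≥ π/2`.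
  have hcpos : 0 < Real.cos (θ - δ) := by rw [hcos]; positivity
  have h1 := Real.neg_pi_div_two_lt_arctan (chordSlope α β θ)
  have h2 := Real.arctan_lt_pi_div_two (chordSlope α β θ)
  have hlt : θ - δ < Real.pi / 2 := by
    by_contra hge
    have := Real.cos_nonpos_of_pi_div_two_le_of_le (x := θ - δ) (by linarith) (by linarith)
    linarith
  have htan' : Real.tan (θ - δ) = chordSlope β α θ := by
    rw [Real.tan_eq_sin_div_cos, div_eq_iff hcpos.ne']
    apply mul_right_cancel₀ hs.ne'
    rw [hsin, mul_right_comm, hm', hcos]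
    field_simp
  rw [← htan', Real.arctan_tan (by linarith) hlt]
  ring

/-! ### Area on the sphere in spherical coordinates -/

/-- The intersection of the open unit ball of `ℝ³` with the cone whose directions have their first
two coordinates in `B`. -/
def ballCone (B : Set (ℝ × ℝ)) : Set (ℝ × ℝ × ℝ) :=
  {y | 0 < Real.sqrt (y.1 ^ 2 + (y.2.1 ^ 2 + y.2.2 ^ 2)) ∧
    Real.sqrt (y.1 ^ 2 + (y.2.1 ^ 2 + y.2.2 ^ 2)) < 1 ∧
    (y.1 / Real.sqrt (y.1 ^ 2 + (y.2.1 ^ 2 + y.2.2 ^ 2)),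
      y.2.1 / Real.sqrt (y.1 ^ 2 + (y.2.1 ^ 2 + y.2.2 ^ 2))) ∈ B}

lemma measurableSet_ballCone {B : Set (ℝ × ℝ)} (hB : MeasurableSet B) :
    MeasurableSet (ballCone B) := by
  have hn : Measurable fun y : ℝ × ℝ × ℝ => Real.sqrt (y.1 ^ 2 + (y.2.1 ^ 2 + y.2.2 ^ 2)) := by
    fun_prop
  refine (measurableSet_lt measurable_const hn).inter
    ((measurableSet_lt hn measurable_const).inter ?_)
  exact ((measurable_fst.div hn).prodMk (measurable_snd.fst.div hn)) hB

/-- The azimuths at which the direction with colatitude `φ` has its first two coordinates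
in `B`. -/
def azimuths (B : Set (ℝ × ℝ)) (φ : ℝ) : Set ℝ :=
  {α | α ∈ Set.Ioo (-Real.pi) Real.pi ∧ (Real.cos φ, Real.sin φ * Real.cos α) ∈ B}

lemma measurable_volume_azimuths {B : Set (ℝ × ℝ)} (hB : MeasurableSet B) :
    Measurable fun φ => volume (azimuths B φ) := by
  have h : MeasurableSet {p : ℝ × ℝ | p.2 ∈ Set.Ioo (-Real.pi) Real.pi ∧
      (Real.cos p.1, Real.sin p.1 * Real.cos p.2) ∈ B} := by
    refine (measurable_snd measurableSet_Ioo).inter ?_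
    have : Measurable fun p : ℝ × ℝ => (Real.cos p.1, Real.sin p.1 * Real.cos p.2) := by fun_prop
    exact this hB
  exact measurable_measure_prodMk_left h

lemma mem_ballCone_spherical {B : Set (ℝ × ℝ)} {R φ α : ℝ} (hR : 0 < R) :
    (R * Real.cos φ, R * Real.sin φ * Real.cos α, R * Real.sin φ * Real.sin α) ∈ ballCone B ↔
      R < 1 ∧ (Real.cos φ, Real.sin φ * Real.cos α) ∈ B := by
  have hn : Real.sqrt ((R * Real.cos φ) ^ 2 + ((R * Real.sin φ * Real.cos α) ^ 2
      + (R * Real.sin φ * Real.sin α) ^ 2)) = R := by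
    rw [show (R * Real.cos φ) ^ 2 + ((R * Real.sin φ * Real.cos α) ^ 2
      + (R * Real.sin φ * Real.sin α) ^ 2) = R ^ 2 by
        linear_combination R ^ 2 * Real.sin φ ^ 2 * Real.sin_sq_add_cos_sq α
          + R ^ 2 * Real.sin_sq_add_cos_sq φ, Real.sqrt_sq hR.le]
  simp only [ballCone, Set.mem_ofPred_eq, hn, hR, true_and]
  rw [mul_div_cancel_left₀ _ hR.ne', mul_assoc, mul_div_cancel_left₀ _ hR.ne']

lemma lintegral_polar_target (f : ℝ × ℝ → ENNReal) (hf : Measurable f) :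
    ∫⁻ z, f z = ∫⁻ R in Set.Ioi (0 : ℝ), ∫⁻ φ in Set.Ioo (-Real.pi) Real.pi,
      ENNReal.ofReal R * f (R * Real.cos φ, R * Real.sin φ) := by
  rw [← lintegral_comp_polarCoord_symm, polarCoord_target, Measure.volume_eq_prod,
    ← Measure.prod_restrict, lintegral_prod]
  · simp
  · simp only [polarCoord_symm_apply, smul_eq_mul]
    have : Measurable fun p : ℝ × ℝ => (p.1 * Real.cos p.2, p.1 * Real.sin p.2) := by fun_prop
    exact ((ENNReal.measurable_ofReal.comp measurable_fst).mul (hf.comp this)).aemeasurable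

lemma lintegral_sq_unit :
    ∫⁻ R in Set.Ioi (0 : ℝ), ENNReal.ofReal R * ENNReal.ofReal R * (Set.Iio (1 : ℝ)).indicator 1 R
      = ENNReal.ofReal (1 / 3) := by
  have h : ∀ R ∈ Set.Ioi (0 : ℝ), ENNReal.ofReal R * ENNReal.ofReal R *
      (Set.Iio (1 : ℝ)).indicator 1 R
      = (Set.Iio (1 : ℝ)).indicator (fun R => ENNReal.ofReal (R ^ 2)) R := by
    intro R hR
    by_cases h1 : R ∈ Set.Iio (1 : ℝ)
    · simp [h1, ← ENNReal.ofReal_mul (le_of_lt hR), sq]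
    · simp [h1]
  rw [setLIntegral_congr_fun measurableSet_Ioi h, lintegral_indicator measurableSet_Iio,
    Measure.restrict_restrict measurableSet_Iio, Set.Iio_inter_Ioi,
    restrict_Ioo_eq_restrict_Ioc, ← ofReal_integral_eq_lintegral_ofReal]
  · rw [← intervalIntegral.integral_of_le zero_le_one, integral_pow]
    norm_num
  · exact (intervalIntegrable_iff_integrableOn_Ioc_of_le zero_le_one).mp
      ((continuous_pow 2).intervalIntegrable _ _)
  · exact Filter.Eventually.of_forall fun R => sq_nonneg R

/-- Spherical coordinates arise from two polar changes of variables: in the plane orthogonal to the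
axis, then in the plane of the axial coordinate and the distance to the axis. The Jacobian is `R · R
sin φ`, and the radial factor is `∫₀¹ R² dR = 1/3`. -/
lemma volume_ballCone {B : Set (ℝ × ℝ)} (hB : MeasurableSet B) :
    volume (ballCone B) = ENNReal.ofReal (1 / 3) *
      ∫⁻ φ in Set.Ioo 0 Real.pi, ENNReal.ofReal (Real.sin φ) * volume (azimuths B φ) := by
  set F : ℝ × ℝ × ℝ → ENNReal := (ballCone B).indicator 1 with hF
  have hFm : Measurable F := measurable_one.indicator (measurableSet_ballCone hB)
  -- `ENNReal.ofReal` sends a negative distance to the axis to 0. So the second polar change may run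
  -- over the whole plane, with no contribution from `φ ≤ 0`.
  set K : (ℝ × ℝ) × ℝ → ENNReal := fun y =>
    ENNReal.ofReal y.1.2 * F (y.1.1, y.1.2 * Real.cos y.2, y.1.2 * Real.sin y.2) with hK
  have hKm : Measurable K := by
    have : Measurable fun y : (ℝ × ℝ) × ℝ =>
        (y.1.1, y.1.2 * Real.cos y.2, y.1.2 * Real.sin y.2) := by fun_prop
    exact (ENNReal.measurable_ofReal.comp measurable_fst.snd).mul (hFm.comp this)
  have hHm : Measurable fun z : ℝ × ℝ => ∫⁻ α in Set.Ioo (-Real.pi) Real.pi, K (z, α) :=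
    hKm.lintegral_prod_right'
  have h1 : volume (ballCone B)
      = ∫⁻ z : ℝ × ℝ, ∫⁻ α in Set.Ioo (-Real.pi) Real.pi, K (z, α) := by
    rw [← lintegral_indicator_one (measurableSet_ballCone hB), Measure.volume_eq_prod,
      lintegral_prod _ hFm.aemeasurable, Measure.volume_eq_prod ℝ ℝ,
      lintegral_prod _ hHm.aemeasurable]
    refine lintegral_congr fun p => ?_
    rw [← Measure.volume_eq_prod, lintegral_polar_target (fun z => F (p, z)) (hFm.comp measurable_prodMk_left),
      ← lintegral_indicator measurableSet_Ioi]
    refine lintegral_congr fun r => ?_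
    by_cases hr : r ∈ Set.Ioi (0 : ℝ)
    · simp [hr, hK]
    · have : ENNReal.ofReal r = 0 := ENNReal.ofReal_of_nonpos (not_lt.mp hr)
      simp [hr, hK, this]
  have h2 : ∀ R ∈ Set.Ioi (0 : ℝ), ∫⁻ φ in Set.Ioo (-Real.pi) Real.pi, ENNReal.ofReal R *
        ∫⁻ α in Set.Ioo (-Real.pi) Real.pi, K ((R * Real.cos φ, R * Real.sin φ), α)
      = ENNReal.ofReal R * ENNReal.ofReal R * (Set.Iio (1 : ℝ)).indicator 1 R *
        ∫⁻ φ in Set.Ioo 0 Real.pi, ENNReal.ofReal (Real.sin φ) * volume (azimuths B φ) := by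
    intro R hR
    have hm : Measurable fun φ => ENNReal.ofReal (Real.sin φ) * volume (azimuths B φ) :=
      (ENNReal.measurable_ofReal.comp Real.measurable_sin).mul (measurable_volume_azimuths hB)
    rw [← lintegral_const_mul _ hm, ← lintegral_indicator measurableSet_Ioo,
      ← lintegral_indicator measurableSet_Ioo]
    refine lintegral_congr fun φ => ?_
    by_cases hφ : φ ∈ Set.Ioo 0 Real.pi
    · have hφ' : φ ∈ Set.Ioo (-Real.pi) Real.pi := ⟨by linarith [hφ.1, hφ.2], hφ.2⟩
      have hin : ∫⁻ α in Set.Ioo (-Real.pi) Real.pi, K ((R * Real.cos φ, R * Real.sin φ), α)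
          = ENNReal.ofReal (R * Real.sin φ) * (Set.Iio (1 : ℝ)).indicator 1 R
            * volume (azimuths B φ) := by
        have hA : MeasurableSet (azimuths B φ) := by
          refine measurableSet_Ioo.inter ?_
          have : Measurable fun α : ℝ => (Real.cos φ, Real.sin φ * Real.cos α) := by fun_prop
          exact this hB
        rw [← lintegral_indicator_one hA, ← lintegral_const_mul _ (measurable_one.indicator hA),
          ← lintegral_indicator measurableSet_Ioo]
        refine lintegral_congr fun α => ?_
        by_cases hα : α ∈ Set.Ioo (-Real.pi) Real.pi
        · have hmem := mem_ballCone_spherical (B := B) (φ := φ) (α := α) hR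
          by_cases h1 : R < 1
          · by_cases hb : (Real.cos φ, Real.sin φ * Real.cos α) ∈ B
            · have : α ∈ azimuths B φ := ⟨hα, hb⟩
              simp [hα, hK, hF, hmem, h1, hb, this]
            · have : α ∉ azimuths B φ := fun h => hb h.2
              simp [hα, hK, hF, hmem, h1, hb, this]
          · simp [hα, hK, hF, hmem, h1]
        · have : α ∉ azimuths B φ := fun h => hα h.1
          simp only [Set.indicator_of_notMem hα, Set.indicator_of_notMem this, mul_zero]
      rw [Set.indicator_of_mem hφ, Set.indicator_of_mem hφ', hin,
        ENNReal.ofReal_mul (le_of_lt hR)]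
      ring
    · rw [Set.indicator_of_notMem hφ]
      by_cases hφ' : φ ∈ Set.Ioo (-Real.pi) Real.pi
      · have h0 : φ ≤ 0 := by
          by_contra h
          exact hφ ⟨not_le.mp h, hφ'.2⟩
        have hs : ENNReal.ofReal (R * Real.sin φ) = 0 := ENNReal.ofReal_of_nonpos
          (mul_nonpos_of_nonneg_of_nonpos (le_of_lt hR)
            (Real.sin_nonpos_of_nonpos_of_neg_pi_le h0 hφ'.1.le))
        simp [hφ', hK, hs]
      · rw [Set.indicator_of_notMem hφ']
  rw [h1, lintegral_polar_target _ hHm, setLIntegral_congr_fun measurableSet_Ioi h2,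
    lintegral_mul_const, lintegral_sq_unit]
  exact ((ENNReal.measurable_ofReal.mul ENNReal.measurable_ofReal).mul
    (measurable_one.indicator measurableSet_Iio))

lemma exists_orthonormalBasis_extending {P Q : Space} (hP : ‖P‖ = 1) (hQ : ‖Q‖ = 1)
    (hPQ : ⟪P, Q⟫ = 0) : ∃ b : OrthonormalBasis (Fin 3) ℝ Space, b 0 = P ∧ b 1 = Q := by
  -- Only the indices 0 and 1 matter; the third entry is a filler.
  have ho : Orthonormal ℝ (({0, 1} : Set (Fin 3)).domRestrict ![P, Q, 0]) := by
    refine ⟨fun ⟨i, hi⟩ => ?_, fun ⟨i, hi⟩ ⟨j, hj⟩ hij => ?_⟩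
    · change ‖(![P, Q, 0] : Fin 3 → Space) i‖ = 1
      rcases hi with rfl | rfl
      · exact hP
      · exact hQ
    · change ⟪(![P, Q, 0] : Fin 3 → Space) i, (![P, Q, 0] : Fin 3 → Space) j⟫ = 0
      rcases hi with rfl | rfl <;> rcases hj with rfl | rfl
      · exact absurd rfl hij
      · exact hPQ
      · exact (real_inner_comm _ _).trans hPQ
      · exact absurd rfl hij
  obtain ⟨b, hb⟩ := ho.exists_orthonormalBasis_extension_of_card_eq (by simp)
  exact ⟨b, by simpa using hb 0 (by simp), by simpa using hb 1 (by simp)⟩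

open scoped Pointwise in
/-- The area of a measurable set of directions that is given by the coordinates with respect to
two orthonormal vectors, in spherical coordinates. -/
theorem toSphere_coordinates {P Q : Space} (hP : ‖P‖ = 1) (hQ : ‖Q‖ = 1) (hPQ : ⟪P, Q⟫ = 0)
    {B : Set (ℝ × ℝ)} (hB : MeasurableSet B) :
    (volume : Measure Space).toSphere {x : Direction | (⟪(x : Space), P⟫, ⟪(x : Space), Q⟫) ∈ B}
      = ∫⁻ φ in Set.Ioo 0 Real.pi, ENNReal.ofReal (Real.sin φ) * volume (azimuths B φ) := by
  obtain ⟨b, hb0, hb1⟩ := exists_orthonormalBasis_extending hP hQ hPQ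
  set T : Space → ℝ × ℝ × ℝ := fun y => (⟪y, b 0⟫, ⟪y, b 1⟫, ⟪y, b 2⟫) with hT
  have hTp : MeasurePreserving T volume volume := by
    have h1 := (PiLp.volume_preserving_ofLp (Fin 3)).comp b.measurePreserving_repr
    have h2 := (volume_preserving_piFinSuccAbove (fun _ : Fin 3 => ℝ) 0).comp h1
    have h3 := ((MeasurePreserving.id volume).prod (volume_preserving_finTwoArrow ℝ)).comp h2
    have hTeq : T = Prod.map id MeasurableEquiv.finTwoArrow ∘
        MeasurableEquiv.piFinSuccAbove (fun _ : Fin 3 => ℝ) 0 ∘ WithLp.ofLp ∘ b.repr := by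
      funext y
      refine Prod.ext ?_ (Prod.ext ?_ ?_)
      · exact (real_inner_comm _ _).trans (b.repr_apply_apply y 0).symm
      · exact (real_inner_comm _ _).trans (b.repr_apply_apply y 1).symm
      · exact (real_inner_comm _ _).trans (b.repr_apply_apply y 2).symm
    rw [hTeq]
    exact h3
  have hnorm : ∀ y : Space, Real.sqrt ((T y).1 ^ 2 + ((T y).2.1 ^ 2 + (T y).2.2 ^ 2)) = ‖y‖ := by
    intro y
    have := b.sum_sq_norm_inner_left y
    rw [Fin.sum_univ_three] at this
    simp only [Real.norm_eq_abs, sq_abs] at this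
    rw [← Real.sqrt_sq (norm_nonneg y), ← this, hT]
    ring_nf
  -- `toSphere` measures a set by the dimension times the volume of the cone over it in the open
  -- unit ball; in the coordinates `T` this cone is `ballCone B`. The dimension 3 later cancels the
  -- radial factor 1/3.
  have hset : Set.Ioo (0 : ℝ) 1 • ((↑) '' {x : Direction |
      (⟪(x : Space), P⟫, ⟪(x : Space), Q⟫) ∈ B} : Set Space) = T ⁻¹' ballCone B := by
    ext y
    simp only [Set.mem_smul, Set.mem_preimage, ballCone, Set.mem_ofPred_eq, hnorm]
    constructor
    · rintro ⟨r, hr, _, ⟨x, hx, rfl⟩, rfl⟩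
      have hx1 : ‖(x : Space)‖ = 1 := by simp
      have hn : ‖r • (x : Space)‖ = r := by
        rw [norm_smul, hx1, mul_one, Real.norm_of_nonneg hr.1.le]
      rw [hn]
      refine ⟨hr.1, hr.2, ?_⟩
      simp only [hT, inner_smul_left, hb0, hb1]
      simpa [mul_div_cancel_left₀ _ hr.1.ne'] using hx
    · rintro ⟨h0, h1, hmem⟩
      refine ⟨‖y‖, ⟨h0, h1⟩, ‖y‖⁻¹ • y, ⟨⟨‖y‖⁻¹ • y, ?_⟩, ?_, rfl⟩, ?_⟩
      · simp [norm_smul, h0.ne']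
      · simp only [hT, hb0, hb1] at hmem
        simp only [Set.mem_ofPred_eq, inner_smul_left]
        simpa [div_eq_inv_mul] using hmem
      · rw [smul_smul, mul_inv_cancel₀ h0.ne', one_smul]
  have hmeas : MeasurableSet {x : Direction | (⟪(x : Space), P⟫, ⟪(x : Space), Q⟫) ∈ B} := by
    have : Measurable fun x : Direction => (⟪(x : Space), P⟫, ⟪(x : Space), Q⟫) := by fun_prop
    exact this hB
  rw [Measure.toSphere_apply' _ hmeas, hset,
    hTp.measure_preimage (measurableSet_ballCone hB).nullMeasurableSet, volume_ballCone hB,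
    ← mul_assoc]
  have : ((Module.finrank ℝ Space : ℕ) : ENNReal) * ENNReal.ofReal (1 / 3) = 1 := by
    rw [finrank_euclideanSpace_fin, ← ENNReal.ofReal_natCast, ← ENNReal.ofReal_mul (by simp)]
    norm_num
  rw [this, one_mul]

/-! ### Areas of caps and cap segments -/

/-- On `(-π, π)`, comparing `cos α` with `m` amounts to comparing `|α|` with `arccos m`, so `A` lies
between the open and the closed interval with endpoints `± arccos m`. Values of `m` outside `[-1,
1]` are covered because `arccos` is constant there. -/
lemma volume_of_lt_cos_of_le_cos {m : ℝ} {A : Set ℝ}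
    (h1 : ∀ α ∈ Set.Ioo (-Real.pi) Real.pi, m < Real.cos α → α ∈ A)
    (h2 : ∀ α ∈ A, α ∈ Set.Ioo (-Real.pi) Real.pi ∧ m ≤ Real.cos α) :
    volume A = ENNReal.ofReal (2 * Real.arccos m) := by
  have habs : ∀ α ∈ Set.Ioo (-Real.pi) Real.pi, Real.arccos (Real.cos α) = |α| := by
    intro α hα
    rw [← Real.cos_abs, Real.arccos_cos (abs_nonneg α) (abs_le.mpr ⟨hα.1.le, hα.2.le⟩)]
  apply le_antisymm
  · have : A ⊆ Set.Icc (-Real.arccos m) (Real.arccos m) := by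
      intro α hα
      rw [Set.mem_Icc, ← abs_le, ← habs α (h2 α hα).1]
      exact Real.antitone_arccos (h2 α hα).2
    refine (measure_mono this).trans (le_of_eq ?_)
    rw [Real.volume_Icc]
    ring_nf
  · have : Set.Ioo (-Real.arccos m) (Real.arccos m) ⊆ A := by
      intro α hα
      have hle := Real.arccos_le_pi m
      have hα' : α ∈ Set.Ioo (-Real.pi) Real.pi := ⟨by linarith [hα.1], by linarith [hα.2]⟩
      refine h1 α hα' ?_
      by_contra hcon
      have h3 := Real.antitone_arccos (not_lt.mp hcon)
      rw [habs α hα'] at h3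
      exact absurd (abs_lt.mpr hα) (not_lt.mpr h3)
    refine le_trans (le_of_eq ?_) (measure_mono this)
    rw [Real.volume_Ioo]
    ring_nf

/-- The area of a part of a spherical cap, given the lengths of its sets of azimuths. -/
lemma toSphere_part_of_cap {P Q : Space} (hP : ‖P‖ = 1) (hQ : ‖Q‖ = 1) (hPQ : ⟪P, Q⟫ = 0)
    {v : ℝ} (hv0 : 0 ≤ v) (hv : v < Real.pi) {B : Set (ℝ × ℝ)} (hB : MeasurableSet B)
    (hBv : ∀ y ∈ B, Real.cos v ≤ y.1) {g : ℝ → ℝ} (hg0 : ∀ φ, 0 ≤ g φ)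
    (hg : IntervalIntegrable (fun φ => Real.sin φ * g φ) volume 0 v)
    (hvol : ∀ φ ∈ Set.Ioc 0 v, volume (azimuths B φ) = ENNReal.ofReal (g φ)) :
    (volume : Measure Space).toSphere {x : Direction | (⟪(x : Space), P⟫, ⟪(x : Space), Q⟫) ∈ B}
      = ENNReal.ofReal (∫ φ in (0 : ℝ)..v, Real.sin φ * g φ) := by
  have hsin : ∀ φ ∈ Set.Ioc 0 v, 0 ≤ Real.sin φ := fun φ hφ =>
    Real.sin_nonneg_of_nonneg_of_le_pi hφ.1.le (hφ.2.trans hv.le)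
  rw [toSphere_coordinates hP hQ hPQ hB, intervalIntegral.integral_of_le hv0,
    ofReal_integral_eq_lintegral_ofReal
      ((intervalIntegrable_iff_integrableOn_Ioc_of_le hv0).mp hg)
      ((ae_restrict_mem measurableSet_Ioc).mono fun φ hφ => mul_nonneg (hsin φ hφ) (hg0 φ)),
    ← lintegral_indicator measurableSet_Ioo, ← lintegral_indicator measurableSet_Ioc]
  refine lintegral_congr fun φ => ?_
  by_cases h1 : φ ∈ Set.Ioc 0 v
  · have h2 : φ ∈ Set.Ioo 0 Real.pi := ⟨h1.1, h1.2.trans_lt hv⟩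
    rw [Set.indicator_of_mem h1, Set.indicator_of_mem h2, hvol φ h1,
      ENNReal.ofReal_mul (hsin φ h1)]
  · rw [Set.indicator_of_notMem h1]
    by_cases h2 : φ ∈ Set.Ioo 0 Real.pi
    · have h3 : v < φ := by
        by_contra h
        exact h1 ⟨h2.1, not_lt.mp h⟩
      have h4 : azimuths B φ = ∅ := by
        refine Set.eq_empty_of_forall_notMem fun α hα => ?_
        exact absurd (hBv _ hα.2)
          (not_le.mpr (Real.cos_lt_cos_of_nonneg_of_le_pi hv0 h2.2.le h3))
      rw [Set.indicator_of_mem h2, h4, measure_empty, mul_zero]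
    · rw [Set.indicator_of_notMem h2]

/-- The area of the part of a spherical cap that is cut off by the great circle of slope `m`,
irrespective of whether points of the great circle are included. -/
lemma toSphere_segment {P Q : Space} (hP : ‖P‖ = 1) (hQ : ‖Q‖ = 1) (hPQ : ⟪P, Q⟫ = 0)
    {v : ℝ} (hv0 : 0 ≤ v) (hv : v < Real.pi / 2) (m : ℝ) {B : Set (ℝ × ℝ)} (hB : MeasurableSet B)
    (h1 : ∀ p q, Real.cos v ≤ p → m * p < q → (p, q) ∈ B)
    (h2 : ∀ p q, (p, q) ∈ B → Real.cos v ≤ p ∧ m * p ≤ q) :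
    (volume : Measure Space).toSphere {x : Direction | (⟪(x : Space), P⟫, ⟪(x : Space), Q⟫) ∈ B}
      = ENNReal.ofReal (2 * halfSegment m v) := by
  have hint : (fun φ => Real.sin φ * (2 * Real.arccos (m / Real.tan φ)))
      = fun φ => 2 * (Real.sin φ * Real.arccos (m / Real.tan φ)) := by
    funext φ
    ring
  rw [toSphere_part_of_cap hP hQ hPQ hv0 (by linarith [Real.pi_pos]) hB
    (g := fun φ => 2 * Real.arccos (m / Real.tan φ)) (fun y hy => (h2 y.1 y.2 hy).1)
    (fun φ => mul_nonneg zero_le_two (Real.arccos_nonneg _)) ?_ ?_, hint,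
    intervalIntegral.integral_const_mul, halfSegment]
  · rw [hint]
    exact (intervalIntegrable_segment_integrand m 0 v).const_mul 2
  · intro φ hφ
    have hφ2 : φ < Real.pi / 2 := hφ.2.trans_lt hv
    have hs : 0 < Real.sin φ := Real.sin_pos_of_pos_of_lt_pi hφ.1 (by linarith)
    have hc : 0 < Real.cos φ := Real.cos_pos_of_mem_Ioo ⟨by linarith [hφ.1], hφ2⟩
    have heq : m / Real.tan φ = m * Real.cos φ / Real.sin φ := by
      rw [Real.tan_eq_sin_div_cos]
      field_simp
    refine volume_of_lt_cos_of_le_cos (fun α hα hlt => ⟨hα, h1 _ _ ?_ ?_⟩) fun α hα => ⟨hα.1, ?_⟩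
    · exact Real.cos_le_cos_of_nonneg_of_le_pi hφ.1.le (by linarith) hφ.2
    · rw [heq, div_lt_iff₀ hs] at hlt
      linarith
    · rw [heq, div_le_iff₀ hs]
      linarith [(h2 _ _ hα.2).2]

lemma exists_unit_orthogonal (P : Space) : ∃ Q : Space, ‖Q‖ = 1 ∧ ⟪P, Q⟫ = 0 := by
  have hne : (ℝ ∙ P)ᗮ ≠ ⊥ := by
    rw [Ne, Submodule.orthogonal_eq_bot_iff]
    intro h
    have h1 := finrank_span_le_card (R := ℝ) ({P} : Set Space)
    rw [h, finrank_top, finrank_euclideanSpace_fin] at h1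
    simp at h1
  obtain ⟨Q, hQmem, hQ0⟩ := Submodule.exists_mem_ne_zero_of_ne_bot hne
  have hQ : ⟪P, Q⟫ = 0 := Submodule.mem_orthogonal_singleton_iff_inner_right.mp hQmem
  refine ⟨‖Q‖⁻¹ • Q, ?_, ?_⟩
  · rw [norm_smul, norm_inv, norm_norm, inv_mul_cancel₀ (norm_ne_zero_iff.mpr hQ0)]
  · rw [inner_smul_right, hQ, mul_zero]

/-- The area of a spherical cap. -/
lemma toSphere_cap {P : Space} (hP : ‖P‖ = 1) {v : ℝ} (hv0 : 0 ≤ v) (hv : v < Real.pi) :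
    (volume : Measure Space).toSphere {x : Direction | Real.cos v ≤ ⟪(x : Space), P⟫}
      = ENNReal.ofReal (2 * Real.pi * (1 - Real.cos v)) := by
  obtain ⟨Q, hQ, hPQ⟩ := exists_unit_orthogonal P
  have := toSphere_part_of_cap hP hQ hPQ hv0 hv (B := {y | Real.cos v ≤ y.1})
    (measurableSet_le measurable_const measurable_fst) (fun y hy => hy)
    (g := fun _ => 2 * Real.pi) (fun _ => by positivity)
    ((Real.continuous_sin.mul continuous_const).intervalIntegrable _ _) ?_
  · rw [intervalIntegral.integral_mul_const, integral_sin, Real.cos_zero, mul_comm] at this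
    exact this
  · intro φ hφ
    have h : azimuths {y | Real.cos v ≤ y.1} φ = Set.Ioo (-Real.pi) Real.pi := by
      refine Set.Subset.antisymm (fun α hα => hα.1) fun α hα => ⟨hα, ?_⟩
      exact Real.cos_le_cos_of_nonneg_of_le_pi hφ.1.le hv.le hφ.2
    rw [h, Real.volume_Ioo]
    ring_nf

/-! ### The intersection of two caps -/

lemma norm_sub_cos_smul_sq {P P' : Space} {θ : ℝ} (hP : ‖P‖ = 1) (hP' : ‖P'‖ = 1)
    (hθ : ⟪P, P'⟫ = Real.cos θ) : ‖P' - Real.cos θ • P‖ ^ 2 = Real.sin θ ^ 2 := by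
  rw [norm_sub_sq_real, inner_smul_right, real_inner_comm, hθ, norm_smul, hP, hP',
    Real.norm_eq_abs, mul_one, sq_abs, Real.sin_sq]
  ring

/-- Two unit vectors at angle `θ`: the second one in terms of the first one and of a unit vector
orthogonal to it. -/
lemma exists_orthogonal_direction {P P' : Space} {θ : ℝ} (hP : ‖P‖ = 1) (hP' : ‖P'‖ = 1)
    (hθ : ⟪P, P'⟫ = Real.cos θ) (hs : 0 < Real.sin θ) :
    ∃ Q : Space, ‖Q‖ = 1 ∧ ⟪P, Q⟫ = 0 ∧ P' = Real.cos θ • P + Real.sin θ • Q := by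
  have hn : ‖P' - Real.cos θ • P‖ = Real.sin θ :=
    (sq_eq_sq₀ (norm_nonneg _) hs.le).mp (norm_sub_cos_smul_sq hP hP' hθ)
  refine ⟨(Real.sin θ)⁻¹ • (P' - Real.cos θ • P), ?_, ?_, ?_⟩
  · rw [norm_smul, hn, norm_inv, Real.norm_of_nonneg hs.le, inv_mul_cancel₀ hs.ne']
  · rw [inner_smul_right, inner_sub_right, inner_smul_right, hθ, real_inner_self_eq_norm_sq, hP]
    ring
  · rw [smul_smul, mul_inv_cancel₀ hs.ne', one_smul]
    abel

/-- With `p`, `q` the coordinates of `x` along `S` and the unit vector orthogonal to it towards `C`,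
the side of the separating circle is the sign of `⟪x, C⟫ cos α - ⟪x, S⟫ cos β`. -/
lemma chordSlope_mul_sub {α β θ : ℝ} (ha : Real.cos α ≠ 0) (hs : Real.sin θ ≠ 0) (p q : ℝ) :
    Real.cos α * Real.sin θ * (q - chordSlope α β θ * p)
      = (Real.cos θ * p + Real.sin θ * q) * Real.cos α - p * Real.cos β := by
  rw [chordSlope, Real.tan_eq_sin_div_cos]
  field_simp
  ring

/-- The area of the intersection of two spherical caps. -/
theorem toSphere_lens {S C : Space} (hS : ‖S‖ = 1) (hC : ‖C‖ = 1) {α β θ : ℝ}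
    (hθ : ⟪S, C⟫ = Real.cos θ) (hα0 : 0 ≤ α) (hα : α < Real.pi / 2) (hβ0 : 0 ≤ β)
    (hβ : β < Real.pi / 2) (hθ0 : 0 < θ) (hθ2 : θ < Real.pi / 2) :
    (volume : Measure Space).toSphere.real
        {x : Direction | Real.cos α ≤ ⟪(x : Space), S⟫ ∧ Real.cos β ≤ ⟪(x : Space), C⟫}
      = 2 * halfSegment (chordSlope α β θ) α + 2 * halfSegment (chordSlope β α θ) β := by
  have hpi := Real.pi_pos
  have ha : 0 < Real.cos α := Real.cos_pos_of_mem_Ioo ⟨by linarith, hα⟩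
  have hb : 0 < Real.cos β := Real.cos_pos_of_mem_Ioo ⟨by linarith, hβ⟩
  have hs : 0 < Real.sin θ := Real.sin_pos_of_pos_of_lt_pi hθ0 (by linarith)
  obtain ⟨Q, hQ, hSQ, hCeq⟩ := exists_orthogonal_direction hS hC hθ hs
  obtain ⟨R, hR, hCR, hSeq⟩ := exists_orthogonal_direction hC hS
    ((real_inner_comm _ _).trans hθ) hs
  have hxC : ∀ x : Space, ⟪x, C⟫ = Real.cos θ * ⟪x, S⟫ + Real.sin θ * ⟪x, Q⟫ := by
    intro x
    conv_lhs => rw [hCeq]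
    rw [inner_add_right, inner_smul_right, inner_smul_right]
  have hxS : ∀ x : Space, ⟪x, S⟫ = Real.cos θ * ⟪x, C⟫ + Real.sin θ * ⟪x, R⟫ := by
    intro x
    conv_lhs => rw [hSeq]
    rw [inner_add_right, inner_smul_right, inner_smul_right]
  -- The separating circle is included on one side and excluded on the other, so that the two parts
  -- are disjoint.
  have hmS : MeasurableSet {y : ℝ × ℝ | Real.cos α ≤ y.1 ∧ chordSlope α β θ * y.1 ≤ y.2} :=
    (measurableSet_le measurable_const measurable_fst).inter
      (measurableSet_le (measurable_fst.const_mul _) measurable_snd)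
  have hmC : MeasurableSet {y : ℝ × ℝ | Real.cos β ≤ y.1 ∧ chordSlope β α θ * y.1 < y.2} :=
    (measurableSet_le measurable_const measurable_fst).inter
      (measurableSet_lt (measurable_fst.const_mul _) measurable_snd)
  have h1 := toSphere_segment hS hQ hSQ hα0 hα (chordSlope α β θ) hmS
    (fun p q hp hq => ⟨hp, hq.le⟩) (fun p q h => h)
  have h2 := toSphere_segment hC hR hCR hβ0 hβ (chordSlope β α θ) hmC
    (fun p q hp hq => ⟨hp, hq⟩) (fun p q h => ⟨h.1, h.2.le⟩)
  have hS' : ∀ x : Space, chordSlope α β θ * ⟪x, S⟫ ≤ ⟪x, Q⟫ ↔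
      ⟪x, S⟫ * Real.cos β ≤ ⟪x, C⟫ * Real.cos α := by
    intro x
    rw [hxC, ← sub_nonneg, ← sub_nonneg (b := ⟪x, S⟫ * Real.cos β),
      ← chordSlope_mul_sub ha.ne' hs.ne', mul_nonneg_iff_of_pos_left (mul_pos ha hs)]
  have hC' : ∀ x : Space, chordSlope β α θ * ⟪x, C⟫ < ⟪x, R⟫ ↔
      ⟪x, C⟫ * Real.cos α < ⟪x, S⟫ * Real.cos β := by
    intro x
    rw [hxS, ← sub_pos, ← sub_pos (b := ⟪x, C⟫ * Real.cos α),
      ← chordSlope_mul_sub hb.ne' hs.ne', mul_pos_iff_of_pos_left (mul_pos hb hs)]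
  simp only [Set.mem_ofPred_eq, hS'] at h1
  simp only [Set.mem_ofPred_eq, hC'] at h2
  -- On each side of the separating circle one cap condition implies the other: `cos α ≤ ⟪x, S⟫` and
  -- `⟪x, S⟫ cos β ≤ ⟪x, C⟫ cos α` force `cos β ≤ ⟪x, C⟫`, and symmetrically.
  have hsplit : {x : Direction | Real.cos α ≤ ⟪(x : Space), S⟫ ∧ Real.cos β ≤ ⟪(x : Space), C⟫}
      = {x : Direction | Real.cos α ≤ ⟪(x : Space), S⟫ ∧
          ⟪(x : Space), S⟫ * Real.cos β ≤ ⟪(x : Space), C⟫ * Real.cos α} ∪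
        {x : Direction | Real.cos β ≤ ⟪(x : Space), C⟫ ∧
          ⟪(x : Space), C⟫ * Real.cos α < ⟪(x : Space), S⟫ * Real.cos β} := by
    ext x
    simp only [Set.mem_union, Set.mem_ofPred_eq]
    constructor
    · rintro ⟨h, h'⟩
      rcases le_or_gt (⟪(x : Space), S⟫ * Real.cos β) (⟪(x : Space), C⟫ * Real.cos α) with hle | hlt
      · exact Or.inl ⟨h, hle⟩
      · exact Or.inr ⟨h', hlt⟩
    · rintro (⟨h, h'⟩ | ⟨h, h'⟩)
      · exact ⟨h, le_of_mul_le_mul_right (by nlinarith) ha⟩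
      · exact ⟨le_of_mul_le_mul_right (by nlinarith) hb, h⟩
  have hdisj : Disjoint {x : Direction | Real.cos α ≤ ⟪(x : Space), S⟫ ∧
          ⟪(x : Space), S⟫ * Real.cos β ≤ ⟪(x : Space), C⟫ * Real.cos α}
        {x : Direction | Real.cos β ≤ ⟪(x : Space), C⟫ ∧
          ⟪(x : Space), C⟫ * Real.cos α < ⟪(x : Space), S⟫ * Real.cos β} :=
    Set.disjoint_left.mpr fun x hx hx' => absurd hx.2 (not_le.mpr hx'.2)
  have hmeas : MeasurableSet {x : Direction | Real.cos β ≤ ⟪(x : Space), C⟫ ∧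
          ⟪(x : Space), C⟫ * Real.cos α < ⟪(x : Space), S⟫ * Real.cos β} := by
    have m1 : Measurable fun x : Direction => ⟪(x : Space), C⟫ := by fun_prop
    have m2 : Measurable fun x : Direction => ⟪(x : Space), S⟫ := by fun_prop
    exact (measurableSet_le measurable_const m1).inter
      (measurableSet_lt (m1.mul_const _) (m2.mul_const _))
  rw [hsplit, measureReal_union hdisj hmeas, Measure.real, Measure.real, h1, h2,
    ENNReal.toReal_ofReal (mul_nonneg zero_le_two (halfSegment_nonneg _ hα0 (by linarith))),
    ENNReal.toReal_ofReal (mul_nonneg zero_le_two (halfSegment_nonneg _ hβ0 (by linarith)))]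

/-! ### The closed form as an area ratio -/

lemma angle_le_iff_cos_le_inner {x P : Space} (hx : ‖x‖ = 1) (hP : ‖P‖ = 1) {v : ℝ}
    (hv0 : 0 ≤ v) (hv : v ≤ Real.pi) :
    InnerProductGeometry.angle x P ≤ v ↔ Real.cos v ≤ ⟪x, P⟫ := by
  have h : Real.cos (InnerProductGeometry.angle x P) = ⟪x, P⟫ := by
    rw [InnerProductGeometry.cos_angle, hx, hP]; simp
  rw [← h]
  exact (Real.strictAntiOn_cos.le_iff_ge ⟨hv0, hv⟩
    ⟨InnerProductGeometry.angle_nonneg _ _, InnerProductGeometry.angle_le_pi _ _⟩).symm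

lemma toSphere_real_cell (C : Direction) {v : ℝ} (hv0 : 0 ≤ v) (hv : v < Real.pi) :
    (volume : Measure Space).toSphere.real (cell C v) = 2 * Real.pi * (1 - Real.cos v) := by
  have h : cell C v = {x : Direction | Real.cos v ≤ ⟪(x : Space), (C : Space)⟫} := by
    ext x
    exact angle_le_iff_cos_le_inner (by simp) (by simp) hv0 hv.le
  rw [h, Measure.real, toSphere_cap (by simp) hv0 hv, ENNReal.toReal_ofReal]
  exact mul_nonneg (by positivity) (sub_nonneg.mpr (Real.cos_le_one v))

/-- The closed form is the share of the cell that lies within central angle `γ` of `S`. -/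
theorem toSphere_real_cell_inter_cell {C S : Direction} {θc θv : ℝ} (hθc : 0 < θc)
    (hθv : InnerProductGeometry.angle (C : Space) (S : Space) = θv)
    (hvis : θv + θc < Real.pi / 2) (γ : ℝ) :
    (volume : Measure Space).toSphere.real (cell C θc ∩ cell S γ)
      = 2 * Real.pi * (1 - Real.cos θc) * centralAngleCDF γ θc θv := by
  have hpi := Real.pi_pos
  have hv0 : 0 ≤ θv := hθv ▸ InnerProductGeometry.angle_nonneg _ _
  have hc1 : 0 < 1 - Real.cos θc := by
    have := Real.cos_lt_cos_of_nonneg_of_le_pi le_rfl (by linarith) hθc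
    rw [Real.cos_zero] at this
    linarith
  have tri1 : ∀ x : Direction, InnerProductGeometry.angle (x : Space) (C : Space) ≤
      InnerProductGeometry.angle (x : Space) (S : Space) + θv := by
    intro x
    rw [← hθv, InnerProductGeometry.angle_comm (C : Space) (S : Space)]
    exact InnerProductGeometry.angle_le_angle_add_angle _ _ _
  have tri2 : ∀ x : Direction, InnerProductGeometry.angle (x : Space) (S : Space) ≤
      InnerProductGeometry.angle (x : Space) (C : Space) + θv := by
    intro x
    rw [← hθv]
    exact InnerProductGeometry.angle_le_angle_add_angle _ _ _
  have tri3 : ∀ x : Direction, θv ≤ InnerProductGeometry.angle (x : Space) (C : Space)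
      + InnerProductGeometry.angle (x : Space) (S : Space) := by
    intro x
    rw [← hθv, InnerProductGeometry.angle_comm (x : Space) (C : Space)]
    exact InnerProductGeometry.angle_le_angle_add_angle _ _ _
  unfold centralAngleCDF
  split_ifs with h1 h2 h3 h4 h5 h6
  · have : cell S γ = ∅ := Set.eq_empty_of_forall_notMem fun x (hx : _ ≤ γ) => by
      linarith [InnerProductGeometry.angle_nonneg (x : Space) (S : Space)]
    simp [this]
  · have : cell S γ ⊆ cell C θc := fun x (hx : _ ≤ γ) => (tri1 x).trans (by linarith)
    rw [Set.inter_eq_right.mpr this, toSphere_real_cell S (not_lt.mp h1) (by linarith)]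
    field_simp
  · have : cell C θc ∩ cell S γ = ∅ :=
      Set.eq_empty_of_forall_notMem fun x ⟨(hx : _ ≤ θc), (hx' : _ ≤ γ)⟩ => by
        linarith [tri3 x]
    simp [this]
  · have : cell C θc ⊆ cell S γ := fun x (hx : _ ≤ θc) => (tri2 x).trans (by linarith)
    rw [Set.inter_eq_left.mpr this, toSphere_real_cell C hθc.le (by linarith), mul_one]
  all_goals
    rw [not_lt] at h1 h3 h4
    rw [not_le] at h2
    -- For `θv = 0` the remaining range `θc - θv < γ ≤ θc + θv` is empty.
    have hv : 0 < θv := by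
      rcases hv0.lt_or_eq with h | h
      · exact h
      · linarith
    have hv2 : θv < Real.pi / 2 := by linarith
    have hγ2 : γ < Real.pi / 2 := by linarith
    have hθc2 : θc < Real.pi / 2 := by linarith
    have hcγ : 0 < Real.cos γ := Real.cos_pos_of_mem_Ioo ⟨by linarith, hγ2⟩
    have hcc : 0 < Real.cos θc := Real.cos_pos_of_mem_Ioo ⟨by linarith, hθc2⟩
    have hcv : 0 < Real.cos θv := Real.cos_pos_of_mem_Ioo ⟨by linarith, hv2⟩
    have hsv : 0 < Real.sin θv := Real.sin_pos_of_pos_of_lt_pi hv (by linarith)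
    have hlens : cell C θc ∩ cell S γ = {x : Direction |
        Real.cos γ ≤ ⟪(x : Space), (S : Space)⟫ ∧ Real.cos θc ≤ ⟪(x : Space), (C : Space)⟫} := by
      ext x
      rw [Set.inter_comm]
      exact and_congr (angle_le_iff_cos_le_inner (by simp) (by simp) h1 (by linarith))
        (angle_le_iff_cos_le_inner (by simp) (by simp) hθc.le (by linarith))
    have hSC : ⟪(S : Space), (C : Space)⟫ = Real.cos θv := by
      rw [← hθv, InnerProductGeometry.cos_angle, real_inner_comm]
      simp
    rw [hlens, toSphere_lens (by simp) (by simp) hSC h1 hγ2 hθc.le hθc2 hv hv2]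
    have hsum := arctan_chordSlope_add h1 hγ2 hθc.le hθc2 hv hv2
    set mS := chordSlope γ θc θv with hmS
    set mC := chordSlope θc γ θv with hmC
    have hmS' : mS * (Real.cos γ * Real.sin θv) = Real.cos θc - Real.cos γ * Real.cos θv := by
      rw [hmS, chordSlope, Real.tan_eq_sin_div_cos]
      field_simp
    have hmC' : mC * (Real.cos θc * Real.sin θv) = Real.cos γ - Real.cos θc * Real.cos θv := by
      rw [hmC, chordSlope, Real.tan_eq_sin_div_cos]
      field_simp
    have hpS : 0 < Real.cos γ * Real.sin θv := mul_pos hcγ hsv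
    have hpC : 0 < Real.cos θc * Real.sin θv := mul_pos hcc hsv
    have hVS : 0 ≤ mS → V (Real.arctan mS) γ = 2 / Real.pi * halfSegment mS γ := fun h => by
      rw [V_eq_halfSegment (Real.arctan_nonneg.mpr h) (Real.arctan_lt_pi_div_two _) h1 hγ2,
        Real.tan_arctan]
    have hVC : 0 ≤ mC → V (Real.arctan mC) θc = 2 / Real.pi * halfSegment mC θc := fun h => by
      rw [V_eq_halfSegment (Real.arctan_nonneg.mpr h) (Real.arctan_lt_pi_div_two _) hθc.le hθc2,
        Real.tan_arctan]
  -- Case 2: the slope seen from `S` is nonpositive, so `θ_min = arctan (-mS)` and the complementary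
  -- segment of the cap around `S` is subtracted.
  · have hneg : mS ≤ 0 := by
      by_contra hcon
      nlinarith [mul_pos (not_le.mp hcon) hpS, h5.2]
    have ht : thetaMin₂ γ θc θv = Real.arctan (-mS) := by
      rw [thetaMin₂, hmS, chordSlope, neg_sub]
    have ht' : θv + thetaMin₂ γ θc θv = Real.arctan mC := by
      rw [ht, Real.arctan_neg]; linarith
    have hmC0 : 0 ≤ mC := by
      rw [← Real.arctan_nonneg, ← ht', ht]
      exact add_nonneg hv0 (Real.arctan_nonneg.mpr (by linarith))
    have hVS' : V (Real.arctan (-mS)) γ = 2 / Real.pi * halfSegment (-mS) γ := by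
      rw [V_eq_halfSegment (Real.arctan_nonneg.mpr (by linarith)) (Real.arctan_lt_pi_div_two _)
        h1 hγ2, Real.tan_arctan]
    rw [ht', ht, hVC hmC0, hVS', halfSegment_neg]
    field_simp
    ring
  -- Case 3: the same with the roles of `S` and `C` exchanged; the full cell supplies the constant
  -- 1.
  · have hneg : mC ≤ 0 := by
      by_contra hcon
      nlinarith [mul_pos (not_le.mp hcon) hpC, h6.2]
    have ht : thetaMin₃ γ θc θv = Real.arctan (-mC) := by
      rw [thetaMin₃, hmC, chordSlope, neg_sub]
    have ht' : θv + thetaMin₃ γ θc θv = Real.arctan mS := by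
      rw [ht, Real.arctan_neg]; linarith
    have hmS0 : 0 ≤ mS := by
      rw [← Real.arctan_nonneg, ← ht', ht]
      exact add_nonneg hv0 (Real.arctan_nonneg.mpr (by linarith))
    have hVC' : V (Real.arctan (-mC)) θc = 2 / Real.pi * halfSegment (-mC) θc := by
      rw [V_eq_halfSegment (Real.arctan_nonneg.mpr (by linarith)) (Real.arctan_lt_pi_div_two _)
        hθc.le hθc2, Real.tan_arctan]
    rw [ht', ht, hVS hmS0, hVC', halfSegment_neg]
    field_simp
    ring
  · have hcγ1 := Real.cos_le_one γ
    have hcc1 := Real.cos_le_one θc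
    -- Case 4: both slopes are nonnegative. Where an earlier case failed only by its comparison of
    -- angles, monotonicity of the cosine gives the inequality.
    have hS0 : Real.cos γ * Real.cos θv ≤ Real.cos θc := by
      by_cases hlt : θv < θc
      · exact (not_le.mp fun h => h5 ⟨hlt, h⟩).le
      · have := Real.cos_le_cos_of_nonneg_of_le_pi hθc.le (by linarith) (not_lt.mp hlt)
        nlinarith
    have hC0 : Real.cos θc * Real.cos θv ≤ Real.cos γ := by
      by_cases hlt : θv < γ
      · exact (not_le.mp fun h => h6 ⟨⟨hlt, by linarith⟩, h⟩).le
      · have := Real.cos_le_cos_of_nonneg_of_le_pi h1 (by linarith) (not_lt.mp hlt)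
        nlinarith
    have hmS0 : 0 ≤ mS := nonneg_of_mul_nonneg_left (by linarith) hpS
    have hmC0 : 0 ≤ mC := nonneg_of_mul_nonneg_left (by linarith) hpC
    have ht : thetaMin₄ γ θc θv = Real.arctan mC := rfl
    have ht' : θv - thetaMin₄ γ θc θv = Real.arctan mS := by
      rw [ht]; linarith
    rw [ht', ht, hVC hmC0, hVS hmS0]
    field_simp
    ring

/-! ### The Doppler bound and the uniformly distributed user -/

lemma rho_pos {fo c re ω : ℝ} (hfo : 0 < fo) (hc : 0 < c) (hre : 0 < re) (hω : 0 < ω) :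
    0 < rho fo c re ω := by
  unfold rho
  positivity

/-- Since `1 + k² - 2k cos y = (1 - k)² + 2k(1 - cos y)`, the inequality is the sum of `sin² y ≤ y²`
weighted by `(1 - k)²` and `sin² y ≤ 2(1 - cos y)` weighted by `k y²`. -/
lemma sin_sq_mul_le {k y : ℝ} (hk : 0 ≤ k) :
    Real.sin y ^ 2 * ((1 - k) ^ 2 + k * y ^ 2)
      ≤ y ^ 2 * (1 + k ^ 2 - 2 * k * Real.cos y) := by
  have h1 : Real.sin y ^ 2 ≤ y ^ 2 := sq_le_sq.mpr Real.abs_sin_le_abs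
  have h2 : Real.sin y ^ 2 ≤ 2 * (1 - Real.cos y) := by
    nlinarith [Real.sin_sq_add_cos_sq y, sq_nonneg (1 - Real.cos y)]
  nlinarith [mul_le_mul_of_nonneg_right h1 (sq_nonneg (1 - k)),
    mul_le_mul_of_nonneg_left h2 (mul_nonneg hk (sq_nonneg y))]

lemma dopplerMagnitude_le_groundTrackApprox {fo c re h ω : ℝ} (hfo : 0 < fo) (hc : 0 < c)
    (hre : 0 < re) (hh : 0 < h) (hω : 0 < ω) {u w : Space} (hu : ‖u‖ = 1) (hw : ‖w‖ = 1)
    (huw : ⟪u, w⟫ = 0) (t : ℝ) {x : Space} (hx : ‖x‖ = 1) :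
    dopplerMagnitude fo c re h u w ω t x
      ≤ groundTrackApprox re h (rho fo c re ω) (centralAngle u w ω t x) := by
  rw [dopplerMagnitude_eq hfo hc hre hh hω hu hw huw t hx, groundTrackApprox,
    mul_assoc (rho fo c re ω)]
  refine mul_le_mul_of_nonneg_left ?_ (rho_pos hfo hc hre hω).le
  set y := centralAngle u w ω t x
  have hy : 0 ≤ y := InnerProductGeometry.angle_nonneg _ _
  set k := re / (re + h) with hk
  have hk0 : 0 < k := by positivity
  have hk1 : k < 1 := (div_lt_one (by linarith)).mpr (by linarith)
  have hden : h ^ 2 + re * (re + h) * y ^ 2 = (re + h) ^ 2 * ((1 - k) ^ 2 + k * y ^ 2) := by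
    rw [hk]
    field_simp
    ring
  have hE : 0 < (1 - k) ^ 2 + k * y ^ 2 := by
    have := pow_pos (sub_pos.mpr hk1) 2
    positivity
  have hD : 0 < 1 + k ^ 2 - 2 * k * Real.cos y := by
    nlinarith [Real.cos_le_one y, pow_pos (sub_pos.mpr hk1) 2]
  rw [hden, Real.sqrt_mul (by positivity), Real.sqrt_sq (by positivity), ← mul_div_assoc (re + h) y,
    mul_div_mul_left _ _ (by positivity : re + h ≠ 0)]
  have hnum : Real.sqrt (Real.cos (minCentralAngle u w ω x) ^ 2 - Real.cos y ^ 2)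
      ≤ Real.sqrt (Real.sin y ^ 2) := by
    apply Real.sqrt_le_sqrt
    nlinarith [Real.cos_sq_le_one (minCentralAngle u w ω x), Real.sin_sq_add_cos_sq y]
  refine (div_le_div_of_nonneg_right hnum (Real.sqrt_nonneg _)).trans ?_
  have hsqrt : y / Real.sqrt ((1 - k) ^ 2 + k * y ^ 2)
      = Real.sqrt (y ^ 2 / ((1 - k) ^ 2 + k * y ^ 2)) := by
    rw [Real.sqrt_div (sq_nonneg y), Real.sqrt_sq hy]
  rw [hsqrt, ← Real.sqrt_div (sq_nonneg _)]
  apply Real.sqrt_le_sqrt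
  rw [div_le_div_iff₀ hD hE]
  exact sin_sq_mul_le hk0.le

/-- Squaring and solving for `y` gives the threshold. The hypothesis `hs` says that `|s|` is below
`ρ / √k`, the limit of the form as `y → ∞`, and makes the radicand positive. -/
lemma groundTrackApprox_le_iff {re h ρ s y : ℝ} (hre : 0 < re) (hh : 0 < h) (hρ : 0 < ρ)
    (hs : re / (re + h) * s ^ 2 < ρ ^ 2) (hy : 0 ≤ y) :
    groundTrackApprox re h ρ y ≤ s ↔
      y ≤ h / (re + h) * s / Real.sqrt (ρ ^ 2 - re / (re + h) * s ^ 2) := by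
  have hr : 0 < re + h := by linarith
  have hG : 0 < Real.sqrt (ρ ^ 2 - re / (re + h) * s ^ 2) := Real.sqrt_pos.mpr (by linarith)
  have hF : 0 < Real.sqrt (h ^ 2 + re * (re + h) * y ^ 2) := Real.sqrt_pos.mpr (by positivity)
  rw [groundTrackApprox, ← mul_div_assoc, div_le_iff₀ hF, le_div_iff₀ hG]
  -- Squaring needs `0 ≤ s`; for negative `s` both sides fail because `y ≥ 0`.
  rcases lt_or_ge s 0 with h0 | h0
  · have h1 : s * Real.sqrt (h ^ 2 + re * (re + h) * y ^ 2) < 0 := mul_neg_of_neg_of_pos h0 hF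
    have h2 : h / (re + h) * s < 0 := mul_neg_of_pos_of_neg (by positivity) h0
    exact iff_of_false (not_le.mpr (h1.trans_le (by positivity)))
      (not_le.mpr (h2.trans_le (by positivity)))
  · rw [← sq_le_sq₀ (by positivity) (by positivity),
      ← sq_le_sq₀ (a := y * _) (by positivity) (by positivity), mul_pow s, mul_pow y, Real.sq_sqrt (by positivity), Real.sq_sqrt (by linarith),
      ← sub_nonneg, ← sub_nonneg (b := y ^ 2 * _)]
    have h1 : s ^ 2 * (h ^ 2 + re * (re + h) * y ^ 2) - (ρ * (re + h) * y) ^ 2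
        = (re + h) ^ 2 * ((h / (re + h) * s) ^ 2
          - y ^ 2 * (ρ ^ 2 - re / (re + h) * s ^ 2)) := by
      field_simp
      ring
    rw [h1, mul_nonneg_iff_of_pos_left (by positivity)]

lemma measurableSet_cell (C : Direction) (γ : ℝ) : MeasurableSet (cell C γ) := by
  have h : Measurable fun x : Direction => InnerProductGeometry.angle (x : Space) (C : Space) := by
    unfold InnerProductGeometry.angle
    exact Real.continuous_arccos.measurable.comp (by fun_prop)
  exact measurableSet_le h measurable_const

/-- The distribution function of the central angle of a uniformly distributed user. -/
theorem centralAngle_distribution {C S : Direction} {θc θv : ℝ} (hθc : 0 < θc)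
    (hθv : InnerProductGeometry.angle (C : Space) (S : Space) = θv)
    (hvis : θv + θc < Real.pi / 2) {Ω : Type*} [MeasurableSpace Ω] (ℙ : Measure Ω)
    (X : Ω → Direction)
    (hX : pdf.IsUniform X (cell C θc) ℙ (volume : Measure Space).toSphere) (γ : ℝ) :
    ℙ.real (X ⁻¹' cell S γ) = centralAngleCDF γ θc θv := by
  have hpi := Real.pi_pos
  have hv0 : 0 ≤ θv := hθv ▸ InnerProductGeometry.angle_nonneg _ _
  have hcos : Real.cos θc < 1 := by
    have := Real.cos_lt_cos_of_nonneg_of_le_pi le_rfl (by linarith) hθc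
    rwa [Real.cos_zero] at this
  have harea : (0 : ℝ) < 2 * Real.pi * (1 - Real.cos θc) :=
    mul_pos (by positivity) (sub_pos.mpr hcos)
  have hcell := toSphere_real_cell C hθc.le (by linarith : θc < Real.pi)
  have hne : (volume : Measure Space).toSphere (cell C θc) ≠ 0 := by
    intro h0
    rw [Measure.real, h0, ENNReal.toReal_zero] at hcell
    linarith
  rw [Measure.real, hX.measure_preimage hne (measure_ne_top _ _) (measurableSet_cell S γ),
    ENNReal.toReal_div]
  change (volume : Measure Space).toSphere.real _ / (volume : Measure Space).toSphere.real _ = _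
  rw [hcell, toSphere_real_cell_inter_cell hθc hθv hvis, mul_div_cancel_left₀ _ harea.ne']

end LeoDoppler

theorem corollary5
    -- carrier frequency, speed of light, Earth's radius, altitude, angular velocity
    (fo c re h ω : ℝ) (hfo : 0 < fo) (hc : 0 < c) (hre : 0 < re) (hh : 0 < h) (hω : 0 < ω)
    -- the orbital plane, the instant, and the cell
    (u w : LeoDoppler.Space) (hu : ‖u‖ = 1) (hw : ‖w‖ = 1) (huw : inner ℝ u w = 0) (t : ℝ)
    (C : LeoDoppler.Direction) (θc θv : ℝ) (hθc : 0 < θc)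
    (hθv : LeoDoppler.centralAngle u w ω t (C : LeoDoppler.Space) = θv)
    (hvis : θv + θc < Real.pi / 2)
    -- a user that is uniformly distributed in the cell
    {Ω : Type*} [MeasurableSpace Ω] (ℙ : MeasureTheory.Measure Ω)
    [MeasureTheory.IsProbabilityMeasure ℙ] (X : Ω → LeoDoppler.Direction)
    (hX : MeasureTheory.pdf.IsUniform X (LeoDoppler.cell C θc) ℙ
      (MeasureTheory.volume : MeasureTheory.Measure LeoDoppler.Space).toSphere)
    (s : ℝ)
    (hs : re / (re + h) * s ^ 2 < LeoDoppler.rho fo c re ω ^ 2) :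
    -- the ground-track small-angle form dominates the Doppler magnitude at every user,
    (∀ x : LeoDoppler.Direction,
      LeoDoppler.dopplerMagnitude fo c re h u w ω t (x : LeoDoppler.Space) ≤
        LeoDoppler.groundTrackApprox re h (LeoDoppler.rho fo c re ω)
          (LeoDoppler.centralAngle u w ω t (x : LeoDoppler.Space))) ∧
    -- the closed form is the distribution function of that upper bound,
    ℙ.real {a | LeoDoppler.groundTrackApprox re h (LeoDoppler.rho fo c re ω)
        (LeoDoppler.centralAngle u w ω t (X a : LeoDoppler.Space)) ≤ s} =
      LeoDoppler.dopplerBound re h (LeoDoppler.rho fo c re ω) θc θv s ∧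
    -- and it bounds the distribution function of the Doppler magnitude.
    LeoDoppler.dopplerBound re h (LeoDoppler.rho fo c re ω) θc θv s ≤
      ℙ.real {a | LeoDoppler.dopplerMagnitude fo c re h u w ω t (X a : LeoDoppler.Space) ≤ s} := by
  have hbound : ∀ x : LeoDoppler.Direction,
      LeoDoppler.dopplerMagnitude fo c re h u w ω t (x : LeoDoppler.Space) ≤
        LeoDoppler.groundTrackApprox re h (LeoDoppler.rho fo c re ω)
          (LeoDoppler.centralAngle u w ω t (x : LeoDoppler.Space)) := fun x =>
    LeoDoppler.dopplerMagnitude_le_groundTrackApprox hfo hc hre hh hω hu hw huw t (by simp)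
  have hdist : ℙ.real {a | LeoDoppler.groundTrackApprox re h (LeoDoppler.rho fo c re ω)
        (LeoDoppler.centralAngle u w ω t (X a : LeoDoppler.Space)) ≤ s} =
      LeoDoppler.dopplerBound re h (LeoDoppler.rho fo c re ω) θc θv s := by
    -- As a unit vector the subsatellite point is the centre of a cap, and a threshold on the
    -- central angle becomes membership in that cap.
    let S : LeoDoppler.Direction := ⟨LeoDoppler.subsatellite u w ω t, by
      rw [mem_sphere_zero_iff_norm, LeoDoppler.norm_subsatellite hu hw huw]⟩
    rw [LeoDoppler.dopplerBound, ← LeoDoppler.centralAngle_distribution (S := S) hθc hθv hvis ℙ X hX]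
    congr 1
    ext a
    exact LeoDoppler.groundTrackApprox_le_iff hre hh (LeoDoppler.rho_pos hfo hc hre hω) hs
      (InnerProductGeometry.angle_nonneg _ _)
  refine ⟨hbound, hdist, ?_⟩
  rw [← hdist]
  -- A user whose upper bound is at most `s` has Doppler magnitude at most `s`.
  exact MeasureTheory.measureReal_mono fun a ha => (hbound (X a)).trans ha
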